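/- Let $\mathbb D=\{z\in\mathbb C:|z|<1\}$ and let $\mathcal A$ be the class of analytic functions $f$ on $\mathbb D$ of the form $f(z)=z+\sum_{n\ge 2}a_nz^n$. Let $\mathcal S^*_{\mathcal B}$ be the class of all $f\in\mathcal A$ for which $\dfrac{zf'(z)}{f(z)}\prec\sqrt{1+\tanh z}$, that is, for which there is an analytic function $w:\mathbb D\to\mathbb D$ with $w(0)=0$ and $|w(z)|\le|z|$ such that $$\frac{zf'(z)}{f(z)}=\sqrt{1+\tanh w(z)}\qquad(z\in\mathbb D),$$ where the square root is the principal branch and the left-hand side is given its limit value $1$ at $z=0$. For such $f$, with $a_1=1$, let $H_q(n)=\det\big(a_{n+i+j}\big)_{0\le i,j\le q-1}$ be its Hankel determinants. **Theorem.** For every $f\in\mathcal S^*_{\mathcal B}$, $$|H_2(3)|=|a_3a_5-a_4^2|\le\frac1{36}.$$ The bound is sharp: the function $$f_0(z)=z\exp\left(\int_0^z\frac{\sqrt{1+\tanh t^3}-1}{t}\,dt\right)$$ belongs to $\mathcal S^*_{\mathcal B}$ and satisfies $|H_2(3)|=\frac1{36}$. -/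

import Mathlib

noncomputable section

/-- The open unit disk in the complex plane. -/
def unitDisk : Set ℂ := Metric.ball 0 1

/-- The class of normalized analytic functions `f(z) = z + a₂ z² + a₃ z³ + ⋯` on the unit disk.
Functions are total on `ℂ`; only their values on the unit disk matter. -/
def normalizedAnalytic : Set (ℂ → ℂ) :=
  {f | DifferentiableOn ℂ f unitDisk ∧ f 0 = 0 ∧ deriv f 0 = 1}

/-- The `n`-th Taylor coefficient `aₙ` of `f` at the origin. -/
def taylorCoeff (f : ℂ → ℂ) (n : ℕ) : ℂ := iteratedDeriv n f 0 / (n.factorial : ℂ)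

/-- The Hankel determinant `H_q(n)`, the determinant of the `q × q` matrix
with entries `a_{n+i+j}`, `0 ≤ i, j < q`. -/
def hankelDet (q n : ℕ) (f : ℂ → ℂ) : ℂ :=
  Matrix.det (Matrix.of fun i j : Fin q => taylorCoeff f (n + (i : ℕ) + (j : ℕ)))

/-- `w` is a Schwarz function: analytic on the unit disk, `w(0) = 0` and `|w(z)| ≤ |z|`. -/
def IsSchwarzFunction (w : ℂ → ℂ) : Prop :=
  DifferentiableOn ℂ w unitDisk ∧ w 0 = 0 ∧ ∀ z ∈ unitDisk, ‖w z‖ ≤ ‖z‖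

/-- Subordination `h ≺ g` on the unit disk. -/
def IsSubordinate (h g : ℂ → ℂ) : Prop :=
  ∃ w : ℂ → ℂ, IsSchwarzFunction w ∧ ∀ z ∈ unitDisk, h z = g (w z)

/-- The function `z f'(z) / f(z)`, with its removable singularity at the origin filled in by
the limit `1` (for normalized `f`). -/
def starlikeQuotient (f : ℂ → ℂ) (z : ℂ) : ℂ :=
  if z = 0 then 1 else z * deriv f z / f z

/-- The class of starlike functions `f` with `z f'(z) / f(z) ≺ φ(z)`. -/
def starlikeClass (φ : ℂ → ℂ) : Set (ℂ → ℂ) :=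
  {f | f ∈ normalizedAnalytic ∧ IsSubordinate (starlikeQuotient f) φ}

/-- The function `√(1 + tanh z)`, with the principal branch of the square root. On the unit disk
`1 + tanh z = 2 / (1 + exp (-2 z))` never lies on the closed negative real axis. -/
def beanMap (z : ℂ) : ℂ := (1 + Complex.tanh z) ^ (1 / 2 : ℂ)

/-- The class of starlike functions associated with the bean-shaped domain. -/
def beanStarlike : Set (ℂ → ℂ) := starlikeClass beanMap

/-- The function `f₀(z) = z exp (∫₀^z (√(1 + tanh t³) - 1) / t dt)`, the integral being taken
along the segment `t = s z`, `0 ≤ s ≤ 1`. -/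
def beanExtremal (z : ℂ) : ℂ :=
  z * Complex.exp
    (∫ s in (0 : ℝ)..1, (beanMap (((s : ℂ) * z) ^ 3) - 1) / ((s : ℂ) * z) * z)

end

open Metric Filter Topology Complex

/-! ### Taylor coefficients -/

/-! Let `φ` be the bean map and `p = zf'/f = φ ∘ w`. Since `φ² = 1 + tanh`, `φ` solves `2φ' = 2φ -
φ³`, so `2p' = (2p - p³)w'`. With `zf' = fp` this gives the `aₙ` recursively from the coefficients
`cₖ` of `w`, and `36 H₂(3)` becomes a polynomial in `c₁, …, c₄` containing the term `-c₃²`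
(`hankel_eq_of_starlikeQuotient_eq_beanMap_comp`).

Of the Schwarz function only `∑ |cₖ|² ≤ 1` is needed (`sum_sq_norm_taylorCoeff_le_one`): the
remaining coefficients are small enough that the triangle inequality gives modulus at most `1`
(`hankel_majorant_le`). Equality holds at `c₃ = 1`, all others `0`, that is, at `w = z³`. -/

theorem DifferentiableOn.analyticAt_zero {f : ℂ → ℂ} (hf : DifferentiableOn ℂ f unitDisk) :
    AnalyticAt ℂ f 0 :=
  hf.analyticAt (isOpen_ball.mem_nhds (mem_ball_self one_pos))

theorem taylorCoeff_zero (f : ℂ → ℂ) : taylorCoeff f 0 = f 0 := by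
  simp [taylorCoeff]

theorem taylorCoeff_one (f : ℂ → ℂ) : taylorCoeff f 1 = deriv f 0 := by
  simp [taylorCoeff]

theorem taylorCoeff_deriv (f : ℂ → ℂ) (n : ℕ) :
    taylorCoeff (deriv f) n = (n + 1) * taylorCoeff f (n + 1) := by
  have h1 : (n.factorial : ℂ) ≠ 0 := by exact_mod_cast n.factorial_ne_zero
  have h2 : (n + 1 : ℂ) ≠ 0 := by exact_mod_cast n.succ_ne_zero
  rw [taylorCoeff, taylorCoeff, iteratedDeriv_succ', Nat.factorial_succ]
  push_cast
  field_simp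

theorem taylorCoeff_mul {f g : ℂ → ℂ} (hf : AnalyticAt ℂ f 0) (hg : AnalyticAt ℂ g 0) (n : ℕ) :
    taylorCoeff (fun z => f z * g z) n =
      ∑ i ∈ Finset.range (n + 1), taylorCoeff f i * taylorCoeff g (n - i) := by
  rw [taylorCoeff, iteratedDeriv_fun_mul hf.contDiffAt hg.contDiffAt, Finset.sum_div]
  refine Finset.sum_congr rfl fun i hi => ?_
  have hi' : i ≤ n := Nat.lt_succ_iff.mp (Finset.mem_range.mp hi)
  have h1 : (n.factorial : ℂ) ≠ 0 := by exact_mod_cast n.factorial_ne_zero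
  have h2 : (i.factorial : ℂ) ≠ 0 := by exact_mod_cast i.factorial_ne_zero
  have h3 : ((n - i).factorial : ℂ) ≠ 0 := by exact_mod_cast (n - i).factorial_ne_zero
  have h4 : (n.choose i : ℂ) * i.factorial * (n - i).factorial = n.factorial := by
    exact_mod_cast Nat.choose_mul_factorial_mul_factorial hi'
  rw [taylorCoeff, taylorCoeff, ← h4]
  have h5 : (n.choose i : ℂ) ≠ 0 := by exact_mod_cast (Nat.choose_pos hi').ne'
  field_simp

theorem taylorCoeff_congr {f g : ℂ → ℂ} (h : Set.EqOn f g unitDisk) (n : ℕ) :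
    taylorCoeff f n = taylorCoeff g n := by
  rw [taylorCoeff, taylorCoeff, h.iteratedDeriv_of_isOpen isOpen_ball n (mem_ball_self one_pos)]

theorem taylorCoeff_pow (m n : ℕ) :
    taylorCoeff (fun z => z ^ m) n = if n = m then 1 else 0 := by
  rw [taylorCoeff, iteratedDeriv_fun_pow_zero]
  split_ifs with h
  · subst h; exact div_self (by exact_mod_cast n.factorial_ne_zero)
  · simp

theorem taylorCoeff_id (n : ℕ) : taylorCoeff (fun z => z) n = if n = 1 then 1 else 0 := by
  simpa using taylorCoeff_pow 1 n

theorem taylorCoeff_const_add (g : ℂ → ℂ) (c : ℂ) {n : ℕ} (hn : n ≠ 0) :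
    taylorCoeff (fun z => c + g z) n = taylorCoeff g n := by
  obtain ⟨m, rfl⟩ := Nat.exists_eq_succ_of_ne_zero hn
  have h : deriv (fun z => c + g z) = deriv g := by
    ext z; simp
  rw [taylorCoeff, taylorCoeff, iteratedDeriv_succ', iteratedDeriv_succ', h]

theorem taylorCoeff_dslope {f : ℂ → ℂ} (hf : DifferentiableOn ℂ f unitDisk) (n : ℕ) :
    taylorCoeff (dslope f 0) n = taylorCoeff f (n + 1) := by
  have hg : DifferentiableOn ℂ (dslope f 0) unitDisk :=
    (Complex.differentiableOn_dslope (isOpen_ball.mem_nhds (mem_ball_self one_pos))).2 hf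
  have h : f = fun z => f 0 + z * dslope f 0 z := by
    ext z
    have := sub_smul_dslope f 0 z
    simp only [sub_zero, smul_eq_mul] at this
    rw [this]; ring
  conv_rhs => rw [h]
  rw [taylorCoeff_const_add _ _ n.succ_ne_zero,
    taylorCoeff_mul (f := fun z => z) analyticAt_id hg.analyticAt_zero, Finset.sum_eq_single 1]
  · rw [show taylorCoeff (fun z => z) 1 = 1 by simp [taylorCoeff_id]]; simp
  · intro i _ hi
    rw [taylorCoeff_id, if_neg hi, zero_mul]
  · simp

/-! ### Bessel's inequality for Taylor coefficients -/

/-- One step of Parseval: expand `|f(0) + z g(z)|²` with `g = dslope f 0` and `|z| = r`. -/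
theorem circleAverage_sq_norm_eq {f : ℂ → ℂ} (hf : DifferentiableOn ℂ f unitDisk) {r : ℝ}
    (h0 : 0 < r) (h1 : r < 1) :
    Real.circleAverage (fun z => ‖f z‖ ^ 2) 0 r =
      ‖f 0‖ ^ 2 + r ^ 2 * Real.circleAverage (fun z => ‖dslope f 0 z‖ ^ 2) 0 r := by
  have hg : DifferentiableOn ℂ (dslope f 0) unitDisk :=
    (Complex.differentiableOn_dslope (isOpen_ball.mem_nhds (mem_ball_self one_pos))).2 hf
  have hsub : closedBall (0 : ℂ) r ⊆ unitDisk := closedBall_subset_ball h1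
  have hsp : sphere (0 : ℂ) r ⊆ unitDisk := sphere_subset_closedBall.trans hsub
  -- The real part of `k` is the cross term; `k` is analytic with `k 0 = 0`, so its circle average
  -- vanishes.
  set k : ℂ → ℂ := fun z => 2 * (starRingEnd ℂ) (f 0) * (z * dslope f 0 z) with hk
  have hkd : DifferentiableOn ℂ k unitDisk :=
    (differentiableOn_id.mul hg).const_mul _
  have hkav : Real.circleAverage k 0 r = 0 := by
    have := DiffContOnCl.circleAverage (f := k) (c := 0) (R := r) (by
      rw [abs_of_pos h0]
      exact (hkd.mono (by rwa [closure_ball _ h0.ne'])).diffContOnCl)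
    rw [this]; simp [hk]
  have hkint : CircleIntegrable k 0 r :=
    (hkd.continuousOn.mono hsp).circleIntegrable h0.le
  have hre : Real.circleAverage (fun z => (k z).re) 0 r = 0 := by
    have := Complex.reCLM.circleAverage_comp_comm hkint
    rw [hkav] at this
    simpa [Function.comp_def] using this
  have hreint : CircleIntegrable (fun z => (k z).re) 0 r :=
    (Complex.continuous_re.comp_continuousOn (hkd.continuousOn.mono hsp)).circleIntegrable h0.le
  have hgint : CircleIntegrable (fun z => r ^ 2 * ‖dslope f 0 z‖ ^ 2) 0 r :=
    (((hg.continuousOn.mono hsp).norm.pow 2).const_smul (r ^ 2)).circleIntegrable h0.le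
  have hcint : CircleIntegrable (fun _ => ‖f 0‖ ^ 2) (0 : ℂ) r :=
    continuousOn_const.circleIntegrable h0.le
  have hcong : Set.EqOn (fun z => ‖f z‖ ^ 2)
      (fun z => (‖f 0‖ ^ 2 + (k z).re) + r ^ 2 * ‖dslope f 0 z‖ ^ 2) (sphere 0 |r|) := by
    intro z hz
    have hz' : ‖z‖ = r := by simpa [abs_of_pos h0] using hz
    have h : f z = f 0 + z * dslope f 0 z := by
      have := sub_smul_dslope f 0 z
      simp only [sub_zero, smul_eq_mul] at this
      rw [this]; ring
    have h2 : r ^ 2 * ‖dslope f 0 z‖ ^ 2 = ‖z * dslope f 0 z‖ ^ 2 := by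
      rw [norm_mul, hz']; ring
    simp only [hk]
    rw [h2, h]
    generalize z * dslope f 0 z = u
    simp only [← Complex.normSq_eq_norm_sq, Complex.normSq_apply]
    simp
    ring
  rw [Real.circleAverage_congr_sphere hcong,
    Real.circleAverage_fun_add (f₁ := fun z => ‖f 0‖ ^ 2 + (k z).re) (hcint.add hreint) hgint,
    Real.circleAverage_fun_add hcint hreint, hre, Real.circleAverage_const, add_zero]
  congr 1
  exact Real.circleAverage_fun_smul (a := r ^ 2) (f := fun z => ‖dslope f 0 z‖ ^ 2)

/-- Induction over all `f` at once: passing to `dslope f 0` shifts the coefficients by one. -/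
theorem sum_sq_norm_taylorCoeff_le_circleAverage (n : ℕ) {f : ℂ → ℂ}
    (hf : DifferentiableOn ℂ f unitDisk) {r : ℝ} (h0 : 0 < r) (h1 : r < 1) :
    ∑ i ∈ Finset.range n, ‖taylorCoeff f i‖ ^ 2 * r ^ (2 * i) ≤
      Real.circleAverage (fun z => ‖f z‖ ^ 2) 0 r := by
  induction n generalizing f with
  | zero =>
    simpa using Real.circleAverage_nonneg_of_nonneg (fun z _ => sq_nonneg ‖f z‖)
  | succ n ih =>
    have hg : DifferentiableOn ℂ (dslope f 0) unitDisk :=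
      (Complex.differentiableOn_dslope (isOpen_ball.mem_nhds (mem_ball_self one_pos))).2 hf
    rw [circleAverage_sq_norm_eq hf h0 h1, Finset.sum_range_succ', taylorCoeff_zero, add_comm]
    have := mul_le_mul_of_nonneg_left (ih hg) (sq_nonneg r)
    rw [Finset.mul_sum] at this
    simp only [mul_zero, pow_zero, mul_one]
    refine add_le_add le_rfl (le_trans (le_of_eq ?_) this)
    refine Finset.sum_congr rfl fun i _ => ?_
    rw [taylorCoeff_dslope hf]; ring

theorem sum_sq_norm_taylorCoeff_le_one (n : ℕ) {f : ℂ → ℂ}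
    (hf : DifferentiableOn ℂ f unitDisk) (hb : ∀ z ∈ unitDisk, ‖f z‖ ≤ 1) :
    ∑ i ∈ Finset.range n, ‖taylorCoeff f i‖ ^ 2 ≤ 1 := by
  -- The bound is obtained for each radius `r < 1`, then `r` tends to `1` in the finite sum.
  have hlim : Tendsto (fun r : ℝ => ∑ i ∈ Finset.range n, ‖taylorCoeff f i‖ ^ 2 * r ^ (2 * i))
      (𝓝[<] 1) (𝓝 (∑ i ∈ Finset.range n, ‖taylorCoeff f i‖ ^ 2)) := by
    have hc : Continuous
        (fun r : ℝ => ∑ i ∈ Finset.range n, ‖taylorCoeff f i‖ ^ 2 * r ^ (2 * i)) := by fun_prop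
    simpa using (hc.tendsto 1).mono_left nhdsWithin_le_nhds
  refine le_of_tendsto hlim ?_
  filter_upwards [Ioo_mem_nhdsLT (zero_lt_one' ℝ)] with r hr
  refine (sum_sq_norm_taylorCoeff_le_circleAverage n hf hr.1 hr.2).trans ?_
  have hsp : sphere (0 : ℂ) r ⊆ unitDisk :=
    sphere_subset_closedBall.trans (closedBall_subset_ball hr.2)
  refine Real.circleAverage_mono_on_of_le_circle
    (((hf.continuousOn.mono hsp).norm.pow 2).circleIntegrable hr.1.le) fun z hz => ?_
  rw [abs_of_pos hr.1] at hz
  exact pow_le_one₀ (norm_nonneg _) (hb z (hsp hz))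

/-! ### The bean map -/

theorem one_add_tanh_eq {z : ℂ} (hz : 1 + exp (-2 * z) ≠ 0) :
    cosh z ≠ 0 ∧ 1 + tanh z = 2 * (1 + exp (-2 * z))⁻¹ := by
  have he : exp z * exp (-2 * z) = exp (-z) := by rw [← Complex.exp_add]; ring_nf
  have hc : 2 * cosh z = exp z * (1 + exp (-2 * z)) := by
    rw [Complex.two_cosh, mul_add, he, mul_one]
  have hc0 : cosh z ≠ 0 := fun h => mul_ne_zero (exp_ne_zero z) hz (by rw [← hc, h, mul_zero])
  refine ⟨hc0, ?_⟩
  rw [tanh_eq_sinh_div_cosh, ← div_eq_mul_inv, eq_div_iff hz]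
  field_simp
  rw [Complex.cosh_add_sinh, ← neg_mul, ← hc, mul_comm]

theorem one_add_exp_mem_slitPlane {z : ℂ} (hz : z ∈ unitDisk) :
    1 + exp (-2 * z) ∈ slitPlane := by
  have hz1 : ‖z‖ < 1 := by simpa [unitDisk] using hz
  have him : |z.im| < 1 := (abs_im_le_norm z).trans_lt hz1
  rw [mem_slitPlane_iff]
  by_cases h : z.im = 0
  · left
    simp [exp_re, h]
    positivity
  -- Here `0 < |2 Im z| < 2 < π`, so the sine does not vanish.
  · right
    have : (1 + exp (-2 * z)).im = -(Real.exp (-2 * z.re) * Real.sin (2 * z.im)) := by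
      simp [exp_im, Real.sin_neg]
    rw [this, neg_ne_zero]
    refine mul_ne_zero (Real.exp_pos _).ne' ?_
    have hpi := Real.pi_gt_three
    rw [abs_lt] at him
    rcases lt_or_gt_of_ne h with h | h
    · exact (Real.sin_neg_of_neg_of_neg_pi_lt (by linarith) (by linarith)).ne
    · exact (Real.sin_pos_of_pos_of_lt_pi (by linarith) (by linarith)).ne'

theorem one_add_tanh_mem_slitPlane {z : ℂ} (hz : z ∈ unitDisk) : 1 + tanh z ∈ slitPlane := by
  have h := one_add_exp_mem_slitPlane hz
  rw [(one_add_tanh_eq (slitPlane_ne_zero h)).2]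
  have hinv : (1 + exp (-2 * z))⁻¹ ∈ slitPlane := by
    have hn : 0 < normSq (1 + exp (-2 * z)) := normSq_pos.2 (slitPlane_ne_zero h)
    rw [mem_slitPlane_iff] at h ⊢
    rw [inv_re, inv_im]
    exact h.imp (fun h => div_pos h hn) (fun h => div_ne_zero (neg_ne_zero.2 h) hn.ne')
  rw [mem_slitPlane_iff] at hinv ⊢
  simpa using hinv

theorem beanMap_ne_zero {z : ℂ} (hz : z ∈ unitDisk) : beanMap z ≠ 0 := by
  rw [beanMap, Ne, cpow_eq_zero_iff]
  exact fun h => slitPlane_ne_zero (one_add_tanh_mem_slitPlane hz) h.1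

theorem beanMap_sq (z : ℂ) : beanMap z ^ 2 = 1 + tanh z := by
  rw [beanMap, ← cpow_nat_mul]
  norm_num

theorem beanMap_zero : beanMap 0 = 1 := by
  simp [beanMap]

/-- From `2φφ' = 1 - tanh² = φ²(2 - φ²)`. This autonomous equation replaces any series expansion of
the square root or of `tanh`. -/
theorem hasDerivAt_beanMap {z : ℂ} (hz : z ∈ unitDisk) :
    HasDerivAt beanMap (beanMap z * (2 - beanMap z ^ 2) / 2) z := by
  have hc := (one_add_tanh_eq (slitPlane_ne_zero (one_add_exp_mem_slitPlane hz))).1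
  have hs := one_add_tanh_mem_slitPlane hz
  have ht : HasDerivAt (fun z => 1 + tanh z) (1 - tanh z ^ 2) z := by
    have := ((hasDerivAt_sinh z).div (hasDerivAt_cosh z) hc).const_add 1
    have h2 : (fun z => 1 + tanh z) = fun z => 1 + (sinh / cosh) z := by
      ext z; simp [tanh_eq_sinh_div_cosh]
    rw [h2]
    refine this.congr_deriv ?_
    rw [tanh_eq_sinh_div_cosh]
    field_simp
  have h := ht.cpow_const (c := 1 / 2) hs
  refine h.congr_deriv ?_
  rw [beanMap_sq, cpow_sub _ _ (slitPlane_ne_zero hs), cpow_one, ← beanMap]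
  have := slitPlane_ne_zero hs
  field_simp
  ring

theorem differentiableOn_beanMap : DifferentiableOn ℂ beanMap unitDisk :=
  fun _ hz => (hasDerivAt_beanMap hz).differentiableAt.differentiableWithinAt

/-! ### Coefficients of functions in the class -/

theorem IsSchwarzFunction.mapsTo {w : ℂ → ℂ} (hw : IsSchwarzFunction w) :
    Set.MapsTo w unitDisk unitDisk := fun z hz => by
  have h1 : ‖z‖ < 1 := by simpa [unitDisk] using hz
  simpa [unitDisk] using (hw.2.2 z hz).trans_lt h1

/-- Coefficient of `zⁿ` in `2p' = (2p - p³)w'`; the right side involves only `p₀, …, pₙ`, so this is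
a recursion for `pₙ₊₁`. -/
theorem taylorCoeff_beanMap_comp {w : ℂ → ℂ} (hw : IsSchwarzFunction w) (n : ℕ) :
    2 * ((n + 1) * taylorCoeff (fun z => beanMap (w z)) (n + 1)) =
      ∑ i ∈ Finset.range (n + 1),
        (2 * taylorCoeff (fun z => beanMap (w z)) i -
          ∑ j ∈ Finset.range (i + 1), taylorCoeff (fun z => beanMap (w z)) j *
            ∑ k ∈ Finset.range (i - j + 1), taylorCoeff (fun z => beanMap (w z)) k *
              taylorCoeff (fun z => beanMap (w z)) (i - j - k)) *
        ((n - i : ℕ) + 1) * taylorCoeff w (n - i + 1) := by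
  set p : ℂ → ℂ := fun z => beanMap (w z) with hp
  have hpd : DifferentiableOn ℂ p unitDisk := differentiableOn_beanMap.comp hw.1 hw.mapsTo
  have hpa := hpd.analyticAt_zero
  have hwa := hw.1.analyticAt_zero
  have hppa : AnalyticAt ℂ (fun z => p z * p z) 0 := hpa.mul hpa
  have hpppa : AnalyticAt ℂ (fun z => p z * (p z * p z)) 0 := hpa.mul hppa
  have h2pa : AnalyticAt ℂ (fun z => 2 * p z) 0 := analyticAt_const.mul hpa
  have hconst (g : ℂ → ℂ) (i : ℕ) :
      taylorCoeff (fun z => 2 * g z) i = 2 * taylorCoeff g i := by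
    rw [taylorCoeff, taylorCoeff, iteratedDeriv_const_mul_field, mul_div_assoc]
  have hode : Set.EqOn (fun z => 2 * deriv p z)
      (fun z => (2 * p z - p z * (p z * p z)) * deriv w z) unitDisk := by
    intro z hz
    have hwz : HasDerivAt w (deriv w z) z :=
      (hw.1.differentiableAt (isOpen_ball.mem_nhds hz)).hasDerivAt
    have h := (hasDerivAt_beanMap (hw.mapsTo hz)).comp z hwz
    have hd : deriv p z = _ := h.deriv
    change 2 * deriv p z = (2 * p z - p z * (p z * p z)) * deriv w z
    rw [hd]
    ring
  have hsub (i : ℕ) : taylorCoeff (fun z => 2 * p z - p z * (p z * p z)) i =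
      2 * taylorCoeff p i - taylorCoeff (fun z => p z * (p z * p z)) i := by
    rw [← hconst, taylorCoeff, taylorCoeff, taylorCoeff, ← sub_div,
      ← iteratedDeriv_fun_sub h2pa.contDiffAt hpppa.contDiffAt]
  have h := taylorCoeff_congr hode n
  rw [hconst, taylorCoeff_deriv,
    taylorCoeff_mul (f := fun z => 2 * p z - p z * (p z * p z))
      (h2pa.sub hpppa) hwa.deriv] at h
  rw [h]
  refine Finset.sum_congr rfl fun i _ => ?_
  rw [hsub, taylorCoeff_deriv, taylorCoeff_mul hpa hppa, mul_assoc]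
  simp only [taylorCoeff_mul hpa hpa]

/-- Coefficient of `zⁿ` in `zf' = fp`. When `p 0 = 1` the term `i = n` is `aₙ`, leaving `(n - 1)aₙ`
in terms of earlier coefficients. -/
theorem taylorCoeff_of_starlikeQuotient_eq {f p : ℂ → ℂ} (hf : f ∈ normalizedAnalytic)
    (hp : DifferentiableOn ℂ p unitDisk) (hp0 : ∀ z ∈ unitDisk, p z ≠ 0)
    (h : ∀ z ∈ unitDisk, starlikeQuotient f z = p z) (n : ℕ) :
    n * taylorCoeff f n =
      ∑ i ∈ Finset.range (n + 1), taylorCoeff f i * taylorCoeff p (n - i) := by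
  have hfa := hf.1.analyticAt_zero
  have heq : Set.EqOn (fun z => z * deriv f z) (fun z => f z * p z) unitDisk := by
    intro z hz
    by_cases hz0 : z = 0
    · simp [hz0, hf.2.1]
    · have h1 := h z hz
      rw [starlikeQuotient, if_neg hz0] at h1
      -- Division by zero gives `0`, so a zero of `f` would make `p z = 0`.
      have hfz : f z ≠ 0 := fun h2 => hp0 z hz (by rw [← h1, h2, div_zero])
      simp only [← h1]
      field_simp
  have h2 := taylorCoeff_congr heq n
  rw [taylorCoeff_mul hfa hp.analyticAt_zero] at h2
  rw [← h2, taylorCoeff_mul (f := fun z => z) analyticAt_id hfa.deriv]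
  cases n with
  | zero => simp [taylorCoeff_id]
  | succ n =>
    rw [Finset.sum_eq_single 1]
    · simp [taylorCoeff_id, taylorCoeff_deriv]
    · intro i _ hi
      simp [taylorCoeff_id, hi]
    · simp

/-- The second Hankel determinant in terms of the coefficients of the Schwarz function. -/
theorem hankel_eq_of_starlikeQuotient_eq_beanMap_comp {f w : ℂ → ℂ} (hf : f ∈ normalizedAnalytic)
    (hw : IsSchwarzFunction w)
    (h : ∀ z ∈ unitDisk, starlikeQuotient f z = beanMap (w z)) {c₁ c₂ c₃ c₄ : ℂ}
    (h₁ : taylorCoeff w 1 = c₁) (h₂ : taylorCoeff w 2 = c₂) (h₃ : taylorCoeff w 3 = c₃)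
    (h₄ : taylorCoeff w 4 = c₄) :
    36 * (taylorCoeff f 3 * taylorCoeff f 5 - taylorCoeff f 4 ^ 2) =
      -c₃ ^ 2 + 9 / 8 * (c₂ * c₄) + 9 / 32 * (c₁ ^ 2 * c₄) - 5 / 16 * (c₁ * c₂ * c₃) +
        113 / 192 * (c₁ ^ 3 * c₃) - c₁ ^ 2 * c₂ ^ 2 - 71 / 384 * (c₁ ^ 4 * c₂) -
        437 / 4608 * c₁ ^ 6 := by
  have hP := taylorCoeff_beanMap_comp hw
  have hF := taylorCoeff_of_starlikeQuotient_eq hf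
    (differentiableOn_beanMap.comp hw.1 hw.mapsTo) (fun z hz => beanMap_ne_zero (hw.mapsTo hz)) h
  have hF0 : taylorCoeff f 0 = 0 := by rw [taylorCoeff_zero, hf.2.1]
  have hF1 : taylorCoeff f 1 = 1 := by rw [taylorCoeff_one, hf.2.2]
  have hP0 : taylorCoeff (fun z => beanMap (w z)) 0 = 1 := by
    rw [taylorCoeff_zero, hw.2.1, beanMap_zero]
  have hcomp : (beanMap ∘ w) = fun z => beanMap (w z) := rfl
  rw [hcomp] at hF
  generalize taylorCoeff (fun z => beanMap (w z)) = P at *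
  generalize taylorCoeff f = a at *
  have P1 : P 1 = c₁ / 2 := by
    have := hP 0
    simp [Finset.sum_range_succ, hP0, h₁] at this
    linear_combination this / 2
  have P2 : P 2 = c₂ / 2 - c₁ ^ 2 / 8 := by
    have := hP 1
    simp [Finset.sum_range_succ, hP0, h₁, h₂, P1] at this
    linear_combination this / 4
  have P3 : P 3 = c₃ / 2 - c₁ * c₂ / 4 - 5 / 48 * c₁ ^ 3 := by
    have := hP 2
    simp [Finset.sum_range_succ, hP0, h₁, h₂, h₃, P1, P2] at this
    linear_combination this / 6
  have P4 : P 4 = c₄ / 2 - (2 * c₁ * c₃ + c₂ ^ 2) / 8 - 5 / 16 * c₁ ^ 2 * c₂ +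
      17 / 384 * c₁ ^ 4 := by
    have := hP 3
    simp [Finset.sum_range_succ, hP0, h₁, h₂, h₃, h₄, P1, P2, P3] at this
    linear_combination this / 8
  have a2 : a 2 = c₁ / 2 := by
    have := hF 2
    simp [Finset.sum_range_succ, hP0, hF0, hF1, P1] at this
    linear_combination this
  have a3 : a 3 = c₂ / 4 + c₁ ^ 2 / 16 := by
    have := hF 3
    simp [Finset.sum_range_succ, hP0, hF0, hF1, P1, P2, a2] at this
    linear_combination this / 2
  have a4 : a 4 = c₃ / 6 + c₁ * c₂ / 24 - 13 / 288 * c₁ ^ 3 := by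
    have := hF 4
    simp [Finset.sum_range_succ, hP0, hF0, hF1, P1, P2, P3, a2, a3] at this
    linear_combination this / 3
  have a5 : a 5 = c₄ / 8 + c₁ * c₃ / 48 - 5 / 48 * c₁ ^ 2 * c₂ - 11 / 1152 * c₁ ^ 4 := by
    have := hF 5
    simp [Finset.sum_range_succ, hP0, hF0, hF1, P1, P2, P3, P4, a2, a3, a4] at this
    linear_combination this / 4
  rw [a3, a4, a5]
  ring

/-! ### The bound -/

/-- Since `a, c ≤ 1` and `ab, ac ≤ 1/2`, every term except `c²` is dominated by a quadratic one. The
`c²` cancels against the constraint, and what remains, `a² + b² + d²` minus `9/8 bd + 9/32 ad +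
383/384 ab + 1793/4608 a²`, is a positive definite form. -/
theorem hankel_majorant_le {a b c d : ℝ} (ha : 0 ≤ a) (hb : 0 ≤ b) (hc : 0 ≤ c) (hd : 0 ≤ d)
    (h : a ^ 2 + b ^ 2 + c ^ 2 + d ^ 2 ≤ 1) :
    c ^ 2 + 9 / 8 * (b * d) + 9 / 32 * (a ^ 2 * d) + 5 / 16 * (a * b * c) +
      113 / 192 * (a ^ 3 * c) + a ^ 2 * b ^ 2 + 71 / 384 * (a ^ 4 * b) +
      437 / 4608 * a ^ 6 ≤ 1 := by
  have ha1 : a ≤ 1 := by nlinarith [sq_nonneg b, sq_nonneg c, sq_nonneg d]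
  have hc1 : c ≤ 1 := by nlinarith [sq_nonneg b, sq_nonneg a, sq_nonneg d]
  have hab : 0 ≤ a * b := mul_nonneg ha hb
  have hab2 : a * b ≤ 1 / 2 := by nlinarith [sq_nonneg (a - b), sq_nonneg c, sq_nonneg d]
  have hac : a * c ≤ 1 / 2 := by nlinarith [sq_nonneg (a - c), sq_nonneg b, sq_nonneg d]
  have t1 : a ^ 2 * d ≤ a * d := by
    have : a * (a * d) ≤ 1 * (a * d) := mul_le_mul_of_nonneg_right ha1 (mul_nonneg ha hd)
    linarith [this, show a ^ 2 * d = a * (a * d) by ring]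
  have t2 : a * b * c ≤ a * b := mul_le_of_le_one_right hab hc1
  have t3 : a ^ 2 * b ^ 2 ≤ 1 / 2 * (a * b) := by
    have := mul_le_mul_of_nonneg_right hab2 hab
    linarith [this, show a ^ 2 * b ^ 2 = a * b * (a * b) by ring]
  have t4 : a ^ 4 * b ≤ a * b := by
    have := mul_le_mul_of_nonneg_right (pow_le_one₀ (n := 3) ha ha1) hab
    linarith [this, show a ^ 4 * b = a ^ 3 * (a * b) by ring]
  have t5 : a ^ 3 * c ≤ 1 / 2 * a ^ 2 := by
    have := mul_le_mul_of_nonneg_right hac (sq_nonneg a)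
    linarith [this, show a ^ 3 * c = a * c * a ^ 2 by ring]
  have t6 : a ^ 6 ≤ a ^ 2 := pow_le_pow_of_le_one ha ha1 (by norm_num)
  -- The squares are aimed at the cross terms `bd`, `ad` and `ab`.
  nlinarith [sq_nonneg (b - d), sq_nonneg (a - 28 / 9 * d), sq_nonneg (a - 9 / 10 * b), sq_nonneg a]

theorem norm_hankel_polynomial_le {c₁ c₂ c₃ c₄ : ℂ}
    (h : ‖c₁‖ ^ 2 + ‖c₂‖ ^ 2 + ‖c₃‖ ^ 2 + ‖c₄‖ ^ 2 ≤ 1) :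
    ‖-c₃ ^ 2 + 9 / 8 * (c₂ * c₄) + 9 / 32 * (c₁ ^ 2 * c₄) - 5 / 16 * (c₁ * c₂ * c₃) +
        113 / 192 * (c₁ ^ 3 * c₃) - c₁ ^ 2 * c₂ ^ 2 - 71 / 384 * (c₁ ^ 4 * c₂) -
        437 / 4608 * c₁ ^ 6‖ ≤ 1 := by
  refine le_trans ?_ (hankel_majorant_le (norm_nonneg c₁) (norm_nonneg c₂) (norm_nonneg c₃)
    (norm_nonneg c₄) h)
  refine (norm_sub_le _ _).trans (add_le_add ((norm_sub_le _ _).trans (add_le_add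
    ((norm_sub_le _ _).trans (add_le_add ((norm_add_le _ _).trans (add_le_add
    ((norm_sub_le _ _).trans (add_le_add ((norm_add_le _ _).trans (add_le_add
    ((norm_add_le _ _).trans (add_le_add ?_ ?_)) ?_)) ?_)) ?_)) ?_)) ?_)) ?_) <;>
  simp [norm_pow]

theorem norm_hankel_le {f : ℂ → ℂ} (hf : f ∈ beanStarlike) :
    ‖taylorCoeff f 3 * taylorCoeff f 5 - taylorCoeff f 4 ^ 2‖ ≤ 1 / 36 := by
  obtain ⟨hn, w, hw, h⟩ := hf
  have hH := hankel_eq_of_starlikeQuotient_eq_beanMap_comp hn hw h rfl rfl rfl rfl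
  -- Five terms cover the indices `0` to `4`; the zeroth vanishes because `w 0 = 0`.
  have hB := sum_sq_norm_taylorCoeff_le_one 5 hw.1 fun z hz => by
    simpa [unitDisk] using (mem_ball_zero_iff.1 (hw.mapsTo hz)).le
  simp only [Finset.sum_range_succ, Finset.sum_range_zero, zero_add, taylorCoeff_zero w,
    hw.2.1, norm_zero] at hB
  have hN := norm_hankel_polynomial_le (c₁ := taylorCoeff w 1) (c₂ := taylorCoeff w 2)
    (c₃ := taylorCoeff w 3) (c₄ := taylorCoeff w 4) (by linarith)
  rw [← hH, norm_mul] at hN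
  norm_num at hN
  linarith

/-! ### The extremal function -/

/-- With the singularity at `0` removed, `(φ(t³) - 1)/t` is a `dslope`, analytic on the disk, so it
has a primitive there and the segment integral evaluates it. -/
theorem exists_beanExtremal_eq :
    ∃ G : ℂ → ℂ, G 0 = 0 ∧
      (∀ z ∈ unitDisk, HasDerivAt G (dslope (fun z => beanMap (z ^ 3)) 0 z) z) ∧
      ∀ z ∈ unitDisk, beanExtremal z = z * exp (G z) := by
  set g : ℂ → ℂ := dslope (fun z => beanMap (z ^ 3)) 0 with hgdef
  have hmaps : Set.MapsTo (fun z : ℂ => z ^ 3) unitDisk unitDisk := fun z hz => by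
    have h1 : ‖z‖ < 1 := by simpa [unitDisk] using hz
    simpa [unitDisk] using pow_lt_one₀ (norm_nonneg z) h1 three_ne_zero
  have hg : DifferentiableOn ℂ g unitDisk :=
    (Complex.differentiableOn_dslope (isOpen_ball.mem_nhds (mem_ball_self one_pos))).2
      (differentiableOn_beanMap.comp (differentiableOn_pow 3) hmaps)
  obtain ⟨G, hG0, hG⟩ := hg.isExactOn_ball.with_val_at 0 0
  refine ⟨G, hG0, hG, fun z hz => ?_⟩
  have hz1 : ‖z‖ < 1 := by simpa [unitDisk] using hz
  have hseg : ∀ s ∈ Set.uIcc (0 : ℝ) 1, (s : ℂ) * z ∈ unitDisk := fun s hs => by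
    rw [Set.uIcc_of_le zero_le_one] at hs
    have : |s| * ‖z‖ < 1 := by
      rw [abs_of_nonneg hs.1]
      exact (mul_le_of_le_one_left (norm_nonneg z) hs.2).trans_lt hz1
    simpa [unitDisk] using this
  have hcont : ContinuousOn (fun s : ℝ => g (s * z) * z) (Set.uIcc 0 1) :=
    (hg.continuousOn.comp (by fun_prop) hseg).mul continuousOn_const
  have hftc : ∫ s in (0 : ℝ)..1, g (s * z) * z = G z := by
    have := intervalIntegral.integral_eq_sub_of_hasDerivAt (f := fun s : ℝ => G (s * z))
      (f' := fun s : ℝ => g (s * z) * z) (a := 0) (b := 1) (fun s hs => by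
        have h1 : HasDerivAt (fun s : ℝ => (s : ℂ) * z) z s := by
          simpa using (Complex.ofRealCLM.hasDerivAt (x := s)).mul_const z
        exact (hG _ (hseg s hs)).comp s h1) hcont.intervalIntegrable
    simpa [hG0] using this
  have hint : ∫ s in (0 : ℝ)..1, (beanMap (((s : ℂ) * z) ^ 3) - 1) / ((s : ℂ) * z) * z =
      ∫ s in (0 : ℝ)..1, g (s * z) * z := by
    -- The half-open interval leaves out `s = 0`, where the integrand is `0/0`.
    refine intervalIntegral.integral_congr_ae (Eventually.of_forall fun s hs => ?_)
    rw [Set.uIoc_of_le zero_le_one] at hs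
    by_cases hz0 : z = 0
    · simp [hz0]
    · have hsz : (s : ℂ) * z ≠ 0 := mul_ne_zero (by exact_mod_cast hs.1.ne') hz0
      rw [hgdef, dslope_of_ne _ hsz, slope_def_field]
      simp [beanMap_zero]
  rw [beanExtremal, hint, hftc]

theorem isSchwarzFunction_cube : IsSchwarzFunction (fun z => z ^ 3) := by
  refine ⟨differentiableOn_pow 3, by simp, fun z hz => ?_⟩
  have h1 : ‖z‖ < 1 := by simpa [unitDisk] using hz
  rw [norm_pow]
  exact pow_le_of_le_one (norm_nonneg z) h1.le three_ne_zero

/-- Logarithmic differentiation of `z exp G` gives `1 + zG' = φ(z³)`. -/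
theorem beanExtremal_spec : beanExtremal ∈ normalizedAnalytic ∧
    ∀ z ∈ unitDisk, starlikeQuotient beanExtremal z = beanMap (z ^ 3) := by
  obtain ⟨G, hG0, hG, hE⟩ := exists_beanExtremal_eq
  have hd : ∀ z ∈ unitDisk, HasDerivAt beanExtremal
      (exp (G z) * (1 + z * dslope (fun z => beanMap (z ^ 3)) 0 z)) z := fun z hz => by
    have h1 := (hasDerivAt_id z).mul (hG z hz).cexp
    refine (h1.congr_of_eventuallyEq ?_).congr_deriv ?_
    · filter_upwards [isOpen_ball.mem_nhds hz] with y hy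
      simpa using hE y hy
    · simp; ring
  have h0 : (0 : ℂ) ∈ unitDisk := mem_ball_self one_pos
  refine ⟨⟨fun z hz => (hd z hz).differentiableAt.differentiableWithinAt, ?_, ?_⟩, fun z hz => ?_⟩
  · simp [hE 0 h0]
  · simp [(hd 0 h0).deriv, hG0]
  · by_cases hz0 : z = 0
    · simp [starlikeQuotient, hz0, beanMap_zero]
    · have hs := sub_smul_dslope (fun z => beanMap (z ^ 3)) 0 z
      simp only [sub_zero, smul_eq_mul] at hs
      rw [starlikeQuotient, if_neg hz0, (hd z hz).deriv, hE z hz, hs]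
      have := exp_ne_zero (G z)
      field_simp
      simp [beanMap_zero]

theorem hankelDet_two_three (f : ℂ → ℂ) :
    hankelDet 2 3 f = taylorCoeff f 3 * taylorCoeff f 5 - taylorCoeff f 4 ^ 2 := by
  simp [hankelDet, Matrix.det_fin_two, sq]

theorem mainTheorem2 :
    (∀ f ∈ beanStarlike,
      hankelDet 2 3 f = taylorCoeff f 3 * taylorCoeff f 5 - taylorCoeff f 4 ^ 2 ∧
      ‖hankelDet 2 3 f‖ ≤ 1 / 36) ∧
    beanExtremal ∈ beanStarlike ∧ ‖hankelDet 2 3 beanExtremal‖ = 1 / 36 := by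
  obtain ⟨hn, hq⟩ := beanExtremal_spec
  refine ⟨fun f hf => ⟨hankelDet_two_three f, ?_⟩,
    ⟨hn, _, isSchwarzFunction_cube, hq⟩, ?_⟩
  · rw [hankelDet_two_three]
    exact norm_hankel_le hf
  · have hH := hankel_eq_of_starlikeQuotient_eq_beanMap_comp hn isSchwarzFunction_cube hq
      (taylorCoeff_pow 3 1) (taylorCoeff_pow 3 2) (taylorCoeff_pow 3 3) (taylorCoeff_pow 3 4)
    rw [← hankelDet_two_three] at hH
    -- Only `c₃ = 1` survives, so the polynomial reduces to `-c₃² = -1`.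
    have : hankelDet 2 3 beanExtremal = -(1 / 36) := by
      norm_num at hH
      linear_combination hH / 36
    rw [this]
    norm_num
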